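/- Let $k$ be a number field. For $x=[x_0,x_1,x_2]\in\mathbb{P}^2(k)$ let $$H_k(x)=\prod_{\nu}\max_{0\le i\le 2}\|x_i\|_\nu$$ be its height relative to $k$, where $\nu$ runs over all places of $k$ and $\|\cdot\|_\nu=|\cdot|_\nu^{[k_\nu:\mathbb{Q}_\mu]}$ is the normalised absolute value; here $\mu$ is the place of $\mathbb{Q}$ below $\nu$ and $|\cdot|_\nu$ is the absolute value that extends the usual one on $\mathbb{Q}_\mu$. Then there is a constant $c_k$, depending only on $k$, such that for every conic $C\subset\mathbb{P}^2$ defined over $k$ by an equation $Q=0$, where $Q\in k[x_0,x_1,x_2]$ is a homogeneous polynomial of degree $2$ that is irreducible over $k$, and for every real number $B\ge 1$, the set of points $x\in C(k)$ with $H_k(x)\le B$ is finite and $$\#\{x\in C(k): H_k(x)\le B\}\le c_k\,B .$$ -/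

import Mathlib

open scoped LinearAlgebra.Projectivization

/-- A ternary form `Q` over a field `k` defines an irreducible plane conic over `k`: it is
homogeneous of degree `2` and irreducible as a polynomial over `k` (in particular nonzero, and
not a product of two linear forms over `k`, so neither a line pair nor a double line over `k`). -/
def IsIrreducibleConic {k : Type*} [Field k] (Q : MvPolynomial (Fin 3) k) : Prop :=
  Q.IsHomogeneous 2 ∧ Irreducible Q

/-- The set `C(k)` of `k`-rational points of the plane curve `C : Q = 0`, as a subset of
`ℙ²(k) = ℙ k (Fin 3 → k)`. For homogeneous `Q` this does not depend on the representatives,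
see `mk_mem_rationalPoints`. -/
def rationalPoints {k : Type*} [Field k] (Q : MvPolynomial (Fin 3) k) : Set (ℙ k (Fin 3 → k)) :=
  {x | MvPolynomial.eval x.rep Q = 0}

theorem mk_mem_rationalPoints {k : Type*} [Field k] {Q : MvPolynomial (Fin 3) k} {n : ℕ}
    (hQ : Q.IsHomogeneous n) (v : Fin 3 → k) (hv : v ≠ 0) :
    Projectivization.mk k v hv ∈ rationalPoints Q ↔ MvPolynomial.eval v Q = 0 := by
  obtain ⟨a, ha⟩ := Projectivization.exists_smul_eq_mk_rep k v hv
  have h : MvPolynomial.eval (a • v) Q = (a : k) ^ n * MvPolynomial.eval v Q := by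
    rw [MvPolynomial.eval_eq, MvPolynomial.eval_eq, Finset.mul_sum]
    refine Finset.sum_congr rfl fun d hd => ?_
    have hdeg : ∑ i ∈ d.support, d i = n := by
      rw [← Finsupp.degree_apply, Finsupp.degree_eq_weight_one]
      exact hQ (MvPolynomial.mem_support_iff.mp hd)
    have hprod : ∏ i ∈ d.support, (a • v) i ^ d i
        = (a : k) ^ n * ∏ i ∈ d.support, v i ^ d i := by
      rw [← hdeg, ← Finset.prod_pow_eq_pow_sum, ← Finset.prod_mul_distrib]
      refine Finset.prod_congr rfl fun i _ => ?_
      rw [Pi.smul_apply, Units.smul_def, smul_eq_mul, mul_pow]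
    rw [hprod]
    ring
  change MvPolynomial.eval (Projectivization.mk k v hv).rep Q = 0 ↔ _
  rw [← ha, h]
  simp

/-- The set counted by `N(C, k, B)`: the points of `C(k)` of height at most `B`. Here
`x.mulHeight` is the height `∏_v sup_i ‖x_i‖_v` over all places of `k`, with respect to the
normalised absolute values (relative to `k`, so complex places are counted with exponent `2`). -/
def rationalPointsOfHeightLE {k : Type*} [Field k] [NumberField k]
    (Q : MvPolynomial (Fin 3) k) (B : ℝ) : Set (ℙ k (Fin 3 → k)) :=
  {x | x ∈ rationalPoints Q ∧ x.mulHeight ≤ B}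

/-! This is a determinant argument at a single place `w` over `3`, with residue field of cardinality
q. Three distinct rational points of an irreducible conic are not collinear
(`IsIrreducibleConic.det_ne_zero`). By the product formula their determinant at `w`, relative to
their sup norms, is then at least a constant times B⁻³ (`supNorm_le_det_mul_mulHeight`). So it
suffices to bound, uniformly in the conic, the number of its points over a discretely valued field
when no three span a triangle of area at most q⁻ⁿ (`card_le_conicBound`). The bound is O(q^(n/3)),
and qⁿ is taken of order B³.

The count is by induction on n, with the Gram matrix scaled to be integral with a unit entry. Near a
point of smooth reduction one affine coordinate is a function of the other. Three such points that
are close together have an area bounded by a Vandermonde product (`conic_area_le`), and pigeonhole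
applies. The remaining points reduce into a line. A linear map whose determinant has absolute value
q does not enlarge their norms, so it multiplies their relative areas by at least q and lowers n by
one (`exists_matrix_of_singular`). The contributions of the smooth points add up to a geometric
series, whatever the reduction of the conic. -/

/-! ### Nonarchimedean absolute values with finite residue field -/

/-- A discrete nonarchimedean absolute value with residue field of odd cardinality `q`, normalised
so that uniformizers have absolute value `q⁻¹`. -/
structure AbsoluteValue.IsOddLocal {K : Type*} [Field K] (v : AbsoluteValue K ℝ) (q : ℕ) :
    Prop where
  nonarch : IsNonarchimedean v
  one_lt : 1 < q
  two : v 2 = 1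
  le_inv_of_lt_one : ∀ x, v x < 1 → v x ≤ (q : ℝ)⁻¹
  exists_uniformizer : ∃ p, v p = (q : ℝ)⁻¹
  exists_residue : ∀ m : ℕ, ∃ r : K → Fin (q ^ m), ∀ x y, v x ≤ 1 → v y ≤ 1 → r x = r y →
    v (x - y) ≤ (q : ℝ)⁻¹ ^ m

namespace AbsoluteValue

variable {K : Type*} [Field K] {v : AbsoluteValue K ℝ}

theorem add_le_of_nonarch (hv : IsNonarchimedean v) {x y : K} {c : ℝ} (hx : v x ≤ c)
    (hy : v y ≤ c) : v (x + y) ≤ c :=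
  (hv x y).trans (max_le hx hy)

theorem sub_le_of_nonarch (hv : IsNonarchimedean v) {x y : K} {c : ℝ} (hx : v x ≤ c)
    (hy : v y ≤ c) : v (x - y) ≤ c := by
  rw [sub_eq_add_neg]
  exact add_le_of_nonarch hv hx (by rwa [v.map_neg])

theorem add_eq_one_of_nonarch (hv : IsNonarchimedean v) {x y : K} (hx : v x = 1)
    (hy : v y < 1) : v (x + y) = 1 := by
  refine le_antisymm (add_le_of_nonarch hv hx.le hy.le) ?_
  by_contra! h
  have h1 : v (x + y - y) ≤ max (v (x + y)) (v y) :=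
    sub_le_of_nonarch hv (le_max_left _ _) (le_max_right _ _)
  rw [add_sub_cancel_right, hx] at h1
  exact absurd h1 (not_le.mpr (max_lt h hy))

theorem mul_le_of_le_one {x y : K} {c : ℝ} (hx : v x ≤ 1) (hy : v y ≤ c) : v (x * y) ≤ c := by
  rw [v.map_mul]
  exact (mul_le_of_le_one_left (v.nonneg _) hx).trans hy

/-- The secant slope of an affine conic near a point where the partial derivative in the first
coordinate is a unit: the first coordinate varies at most as much as the second one. -/
theorem conic_sub_eq {a b c d e f X₁ Y₁ X₂ Y₂ : K}
    (h₁ : a + 2 * b * X₁ + 2 * c * Y₁ + d * X₁ ^ 2 + 2 * e * X₁ * Y₁ + f * Y₁ ^ 2 = 0)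
    (h₂ : a + 2 * b * X₂ + 2 * c * Y₂ + d * X₂ ^ 2 + 2 * e * X₂ * Y₂ + f * Y₂ ^ 2 = 0) :
    (X₂ - X₁) * (2 * (b + d * X₂ + e * Y₂) + d * (X₁ - X₂)) =
      -(Y₂ - Y₁) * (2 * c + 2 * e * X₁ + f * (Y₁ + Y₂)) := by
  linear_combination h₂ - h₁

/-- Three points on an affine conic that are congruent to each other modulo a valuation ideal, with
unit partial derivative in the first coordinate, span a triangle of small area. -/
theorem conic_area_le (hv : IsNonarchimedean v) (h2 : v 2 = 1) {a b c d e f : K}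
    (hc : v c ≤ 1) (hd : v d ≤ 1) (he : v e ≤ 1) (hf : v f ≤ 1) {X Y : Fin 3 → K}
    (hX : ∀ i, v (X i) ≤ 1) (hY : ∀ i, v (Y i) ≤ 1)
    (h : ∀ i, a + 2 * b * X i + 2 * c * Y i + d * X i ^ 2 + 2 * e * X i * Y i + f * Y i ^ 2 = 0)
    (hg : ∀ i, v (b + d * X i + e * Y i) = 1) (hXX : ∀ i j, v (X i - X j) < 1) :
    v ((X 1 - X 0) * (Y 2 - Y 0) - (X 2 - X 0) * (Y 1 - Y 0)) ≤
      v (Y 1 - Y 0) * v (Y 2 - Y 0) * v (Y 1 - Y 2) := by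
  -- The denominator of the secant slope is twice the unit partial derivative plus a small term;
  -- this uses that 2 is a unit.
  have hP : ∀ i j, v (2 * (b + d * X j + e * Y j) + d * (X i - X j)) = 1 := fun i j => by
    refine add_eq_one_of_nonarch hv (by rw [v.map_mul, h2, hg, one_mul]) ?_
    rw [v.map_mul]
    exact (mul_le_of_le_one_left (v.nonneg _) hd).trans_lt (hXX i j)
  have hR : ∀ i j, v (2 * c + 2 * e * X i + f * (Y i + Y j)) ≤ 1 := fun i j => by
    refine add_le_of_nonarch hv (add_le_of_nonarch hv ?_ ?_) ?_
    · exact mul_le_of_le_one h2.le hc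
    · exact mul_le_of_le_one (mul_le_of_le_one h2.le he) (hX i)
    · exact mul_le_of_le_one hf (add_le_of_nonarch hv (hY i) (hY j))
  have hXY : v (X 1 - X 2) ≤ v (Y 1 - Y 2) := by
    have := congrArg v (conic_sub_eq (h 2) (h 1))
    rw [v.map_mul, hP, mul_one, v.map_mul, v.map_neg] at this
    rw [this]
    exact mul_le_of_le_one_right (v.nonneg _) (hR _ _)
  -- With slopes -Rᵢ/Pᵢ of the secants through point 0, the area times P₁P₂ is (Y₁ - Y₀)(Y₂ -
  -- Y₀)(R₂P₁ - R₁P₂). The last factor equals R₁(P₁ - P₂) - P₁(R₁ - R₂), which is of size at most `v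
  -- (Y 1 - Y 2)`.
  have key : ((X 1 - X 0) * (Y 2 - Y 0) - (X 2 - X 0) * (Y 1 - Y 0)) *
      ((2 * (b + d * X 1 + e * Y 1) + d * (X 0 - X 1)) *
        (2 * (b + d * X 2 + e * Y 2) + d * (X 0 - X 2))) =
      ((Y 1 - Y 0) * (Y 2 - Y 0)) *
        ((2 * c + 2 * e * X 0 + f * (Y 0 + Y 1)) * (d * (X 1 - X 2) + 2 * e * (Y 1 - Y 2)) -
          (2 * (b + d * X 1 + e * Y 1) + d * (X 0 - X 1)) * (f * (Y 1 - Y 2))) := by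
    linear_combination (Y 2 - Y 0) * (2 * (b + d * X 2 + e * Y 2) + d * (X 0 - X 2)) *
      conic_sub_eq (h 0) (h 1) - (Y 1 - Y 0) *
      (2 * (b + d * X 1 + e * Y 1) + d * (X 0 - X 1)) * conic_sub_eq (h 0) (h 2)
  have := congrArg v key
  rw [v.map_mul, v.map_mul (2 * (b + d * X 1 + e * Y 1) + d * (X 0 - X 1)), hP, hP, mul_one,
    mul_one, v.map_mul, v.map_mul (Y 1 - Y 0)] at this
  rw [this]
  refine mul_le_mul_of_nonneg_left ?_ (mul_nonneg (v.nonneg _) (v.nonneg _))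
  refine sub_le_of_nonarch hv (mul_le_of_le_one (hR _ _) (add_le_of_nonarch hv ?_ ?_))
    (mul_le_of_le_one (hP _ _).le (mul_le_of_le_one hf le_rfl))
  · exact mul_le_of_le_one hd hXY
  · exact mul_le_of_le_one (mul_le_of_le_one h2.le he) le_rfl

end AbsoluteValue

/-! ### Counting points on a conic over a discretely valued field -/

namespace AbsoluteValue

open Matrix

variable {K : Type*} [Field K] {v : AbsoluteValue K ℝ} {q : ℕ}

/-- The sup norm on `K³` attached to an absolute value on `K`. -/
noncomputable def supNorm (v : AbsoluteValue K ℝ) (x : Fin 3 → K) : ℝ := ⨆ i, v (x i)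

theorem le_supNorm (v : AbsoluteValue K ℝ) (x : Fin 3 → K) (i : Fin 3) : v (x i) ≤ v.supNorm x :=
  le_ciSup (Set.finite_range fun i => v (x i)).bddAbove i

theorem exists_eq_supNorm (v : AbsoluteValue K ℝ) (x : Fin 3 → K) :
    ∃ i, v (x i) = v.supNorm x :=
  exists_eq_ciSup_of_finite

theorem supNorm_le {x : Fin 3 → K} {c : ℝ} (h : ∀ i, v (x i) ≤ c) : v.supNorm x ≤ c :=
  ciSup_le h

theorem supNorm_pos {x : Fin 3 → K} (hx : x ≠ 0) : 0 < v.supNorm x := by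
  obtain ⟨i, hi⟩ := Function.ne_iff.mp hx
  exact (v.pos hi).trans_le (v.le_supNorm x i)

theorem supNorm_nonneg (v : AbsoluteValue K ℝ) (x : Fin 3 → K) : 0 ≤ v.supNorm x :=
  (v.nonneg _).trans (v.le_supNorm x 0)

/-- Pigeonhole in the affine chart where coordinate 0 is largest: the classes fix X modulo the
maximal ideal and Y modulo its m-th power. Three points in one class would have area at most q⁻³ᵐ,
so each of the q · qᵐ classes holds at most two. -/
theorem card_chart_le (hv : v.IsOddLocal q) {G : Matrix (Fin 3) (Fin 3) K} (hG : G.IsSymm)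
    (hG1 : ∀ i j, v (G i j) ≤ 1) {ι : Type*} (S : Finset ι) (u : ι → Fin 3 → K) {m : ℕ}
    (h0 : ∀ a ∈ S, u a 0 ≠ 0) (hle : ∀ a ∈ S, ∀ i, v (u a i) ≤ v (u a 0))
    (hQ : ∀ a ∈ S, u a ⬝ᵥ G *ᵥ u a = 0) (hgr : ∀ a ∈ S, v ((G *ᵥ u a) 1) = v (u a 0))
    (hdet : ∀ a ∈ S, ∀ b ∈ S, ∀ c ∈ S, a ≠ b → a ≠ c → b ≠ c →
      (q : ℝ)⁻¹ ^ (3 * m) * (v (u a 0) * v (u b 0) * v (u c 0)) <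
        v (of ![u a, u b, u c]).det) :
    S.card ≤ 2 * (q * q ^ m) := by
  classical
  obtain ⟨r, hr⟩ := hv.exists_residue 1
  obtain ⟨s, hs⟩ := hv.exists_residue m
  have hq0 : (0 : ℝ) < q := by exact_mod_cast (zero_lt_one.trans hv.one_lt)
  have hq1 : (q : ℝ)⁻¹ < 1 := inv_lt_one_of_one_lt₀ (by exact_mod_cast hv.one_lt)
  have hcard := Finset.card_le_mul_card_image_of_maps_to (s := S)
    (f := fun a => (r (u a 1 / u a 0), s (u a 2 / u a 0)))
    (t := Finset.univ) (fun _ _ => Finset.mem_univ _) 2 ?_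
  · simpa using hcard
  rintro ⟨α, β⟩ -
  by_contra! hlt
  obtain ⟨a, b, c, ha, hb, hc, hab, hac, hbc⟩ := Finset.two_lt_card_iff.mp hlt
  simp only [Finset.mem_filter, Prod.mk.injEq] at ha hb hc
  obtain ⟨ha, har, has⟩ := ha
  obtain ⟨hb, hbr, hbs⟩ := hb
  obtain ⟨hc, hcr, hcs⟩ := hc
  have hp : ∃ p : Fin 3 → ι, p 0 = a ∧ p 1 = b ∧ p 2 = c := ⟨![a, b, c], rfl, rfl, rfl⟩
  obtain ⟨p, rfl, rfl, rfl⟩ := hp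
  have hpS : ∀ i, p i ∈ S := Fin.forall_fin_succ.mpr ⟨ha, Fin.forall_fin_two.mpr ⟨hb, hc⟩⟩
  have hpr : ∀ i, r (u (p i) 1 / u (p i) 0) = α :=
    Fin.forall_fin_succ.mpr ⟨har, Fin.forall_fin_two.mpr ⟨hbr, hcr⟩⟩
  have hps : ∀ i, s (u (p i) 2 / u (p i) 0) = β :=
    Fin.forall_fin_succ.mpr ⟨has, Fin.forall_fin_two.mpr ⟨hbs, hcs⟩⟩
  have hp0 : ∀ i, u (p i) 0 ≠ 0 := fun i => h0 _ (hpS i)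
  have hdiv : ∀ i j, v (u (p i) j / u (p i) 0) ≤ 1 := fun i j => by
    rw [map_div₀]
    exact div_le_one_of_le₀ (hle _ (hpS i) j) (v.nonneg _)
  have hXX : ∀ i j, v (u (p i) 1 / u (p i) 0 - u (p j) 1 / u (p j) 0) < 1 := fun i j => by
    refine lt_of_le_of_lt (hr _ _ (hdiv i 1) (hdiv j 1) ((hpr i).trans (hpr j).symm)) ?_
    rwa [pow_one]
  have hYY : ∀ i j, v (u (p i) 2 / u (p i) 0 - u (p j) 2 / u (p j) 0) ≤ (q : ℝ)⁻¹ ^ m :=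
    fun i j => hs _ _ (hdiv i 2) (hdiv j 2) ((hps i).trans (hps j).symm)
  have area := conic_area_le hv.nonarch hv.two (a := G 0 0) (b := G 0 1) (c := G 0 2) (d := G 1 1)
    (e := G 1 2) (f := G 2 2) (hG1 _ _) (hG1 _ _) (hG1 _ _) (hG1 _ _)
    (X := fun i => u (p i) 1 / u (p i) 0) (Y := fun i => u (p i) 2 / u (p i) 0)
    (fun i => hdiv i 1) (fun i => hdiv i 2) ?_ ?_ hXX
  · have hd : (of ![u (p 0), u (p 1), u (p 2)]).det = (u (p 0) 0 * u (p 1) 0 * u (p 2) 0) *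
        ((u (p 1) 1 / u (p 1) 0 - u (p 0) 1 / u (p 0) 0) *
          (u (p 2) 2 / u (p 2) 0 - u (p 0) 2 / u (p 0) 0) -
        (u (p 2) 1 / u (p 2) 0 - u (p 0) 1 / u (p 0) 0) *
          (u (p 1) 2 / u (p 1) 0 - u (p 0) 2 / u (p 0) 0)) := by
      have := hp0 0
      have := hp0 1
      have := hp0 2
      rw [det_fin_three]
      simp only [of_apply, cons_val_zero, cons_val_one, cons_val]
      field_simp
      ring
    have h1 := hdet _ (hpS 0) _ (hpS 1) _ (hpS 2) hab hac hbc
    rw [hd, v.map_mul, v.map_mul, v.map_mul, mul_comm] at h1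
    have h2 := lt_of_mul_lt_mul_left h1
      (mul_nonneg (mul_nonneg (v.nonneg _) (v.nonneg _)) (v.nonneg _))
    refine absurd (h2.trans_le area) (not_lt.mpr ?_)
    have hqm : 0 ≤ (q : ℝ)⁻¹ ^ m := by positivity
    calc _ ≤ (q : ℝ)⁻¹ ^ m * (q : ℝ)⁻¹ ^ m * (q : ℝ)⁻¹ ^ m :=
          mul_le_mul (mul_le_mul (hYY _ _) (hYY _ _) (v.nonneg _) hqm) (hYY _ _) (v.nonneg _)
            (mul_nonneg hqm hqm)
      _ = (q : ℝ)⁻¹ ^ (3 * m) := by rw [← pow_add, ← pow_add]; congr 1; ring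
  · intro i
    have h1 := hQ _ (hpS i)
    have := hp0 i
    have h10 : G 1 0 = G 0 1 := hG.apply 0 1
    have h20 : G 2 0 = G 0 2 := hG.apply 0 2
    have h21 : G 2 1 = G 1 2 := hG.apply 1 2
    simp only [dotProduct, mulVec, Fin.sum_univ_three, h10, h20, h21] at h1
    field_simp
    linear_combination h1
  · intro i
    have h1 := hgr _ (hpS i)
    have h3 : G 0 1 + G 1 1 * (u (p i) 1 / u (p i) 0) + G 1 2 * (u (p i) 2 / u (p i) 0) =
        (G *ᵥ u (p i)) 1 / u (p i) 0 := by
      have := hp0 i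
      have h10 : G 1 0 = G 0 1 := hG.apply 0 1
      simp only [dotProduct, mulVec, Fin.sum_univ_three, h10]
      field_simp
    rw [h3, map_div₀, h1, div_self (v.ne_zero (hp0 i))]

/-- If both vectors attained the size `N` jointly only at `j`, that term of the sum could not be
cancelled. Applied to a point and its gradient, this yields a unit partial derivative in a
coordinate other than the one used to dehomogenise. -/
theorem exists_ne_eq_of_sum_eq_zero (hv : IsNonarchimedean v) {N : ℝ} {x y : Fin 3 → K}
    (hx : ∀ i, v (x i) ≤ N) (hy : ∀ i, v (y i) ≤ N) {j : Fin 3} (hxj : v (x j) = N)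
    (hsum : x ⬝ᵥ y = 0) {i : Fin 3} (hyi : v (y i) = N) : ∃ k, k ≠ j ∧ v (y k) = N := by
  by_cases hij : i = j
  · subst hij
    by_contra! h
    have hN : 0 ≤ N := hxj ▸ v.nonneg _
    have hlt : ∀ k, k ≠ i → v (x k * y k) < N * N := fun k hk => by
      have h1 := lt_of_le_of_ne (hy k) (h k hk)
      have h2 : 0 < N := (v.nonneg _).trans_lt h1
      rw [v.map_mul]
      calc _ ≤ N * v (y k) := mul_le_mul_of_nonneg_right (hx k) (v.nonneg _)
        _ < N * N := mul_lt_mul_of_pos_left h1 h2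
    have hne : ∃ a b : Fin 3, a ≠ i ∧ b ≠ i ∧ x i * y i = -(x a * y a + x b * y b) := by
      rw [dotProduct, Fin.sum_univ_three] at hsum
      fin_cases i
      · exact ⟨1, 2, by decide, by decide, show x 0 * y 0 = _ by linear_combination hsum⟩
      · exact ⟨0, 2, by decide, by decide, show x 1 * y 1 = _ by linear_combination hsum⟩
      · exact ⟨0, 1, by decide, by decide, show x 2 * y 2 = _ by linear_combination hsum⟩
    obtain ⟨a, b, ha, hb, hab⟩ := hne
    have h1 : v (x i * y i) < N * N := by
      rw [hab, v.map_neg]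
      exact (hv _ _).trans_lt (max_lt (hlt a ha) (hlt b hb))
    rw [v.map_mul, hxj, hyi] at h1
    exact lt_irrefl _ h1
  · exact ⟨i, hij, hyi⟩

theorem mulVec_le (hv : IsNonarchimedean v) {G : Matrix (Fin 3) (Fin 3) K}
    (hG1 : ∀ i j, v (G i j) ≤ 1) (x : Fin 3 → K) (i : Fin 3) : v ((G *ᵥ x) i) ≤ v.supNorm x := by
  rw [mulVec, dotProduct, Fin.sum_univ_three]
  have h : ∀ j, v (G i j * x j) ≤ v.supNorm x := fun j => mul_le_of_le_one (hG1 _ _) (v.le_supNorm x j)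
  exact add_le_of_nonarch hv (add_le_of_nonarch hv (h 0) (h 1)) (h 2)

/-- The six charts are the permutations `σ` for which coordinate `σ 0` is largest and the partial
derivative in direction `σ 1` has full size. Each is brought to the standard chart by permuting
coordinates. -/
theorem card_smooth_le (hv : v.IsOddLocal q) {G : Matrix (Fin 3) (Fin 3) K} (hG : G.IsSymm)
    (hG1 : ∀ i j, v (G i j) ≤ 1) {ι : Type*} (S : Finset ι) (u : ι → Fin 3 → K) {m : ℕ}
    (h0 : ∀ a ∈ S, u a ≠ 0) (hQ : ∀ a ∈ S, u a ⬝ᵥ G *ᵥ u a = 0)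
    (hgr : ∀ a ∈ S, ∃ i, v ((G *ᵥ u a) i) = v.supNorm (u a))
    (hdet : ∀ a ∈ S, ∀ b ∈ S, ∀ c ∈ S, a ≠ b → a ≠ c → b ≠ c →
      (q : ℝ)⁻¹ ^ (3 * m) * (v.supNorm (u a) * v.supNorm (u b) * v.supNorm (u c)) <
        v (of ![u a, u b, u c]).det) :
    S.card ≤ 6 * (2 * (q * q ^ m)) := by
  classical
  let T : Equiv.Perm (Fin 3) → Finset ι := fun σ => S.filter fun a =>
    v (u a (σ 0)) = v.supNorm (u a) ∧ v ((G *ᵥ u a) (σ 1)) = v.supNorm (u a)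
  have hsub : S ⊆ Finset.univ.biUnion T := by
    intro a ha
    obtain ⟨j, hj⟩ := v.exists_eq_supNorm (u a)
    obtain ⟨i, hi⟩ := hgr a ha
    obtain ⟨k, hkj, hk⟩ := exists_ne_eq_of_sum_eq_zero hv.nonarch (v.le_supNorm (u a))
      (mulVec_le hv.nonarch hG1 (u a)) hj (hQ a ha) hi
    have hσ : ∀ j k : Fin 3, k ≠ j → ∃ σ : Equiv.Perm (Fin 3), σ 0 = j ∧ σ 1 = k := by decide
    obtain ⟨σ, rfl, rfl⟩ := hσ j k hkj
    exact Finset.mem_biUnion.mpr ⟨σ, Finset.mem_univ _, Finset.mem_filter.mpr ⟨ha, hj, hk⟩⟩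
  have hT : ∀ σ ∈ (Finset.univ : Finset (Equiv.Perm (Fin 3))), (T σ).card ≤ 2 * (q * q ^ m) := by
    rintro σ -
    have hmem : ∀ a ∈ T σ, a ∈ S ∧ v (u a (σ 0)) = v.supNorm (u a) ∧
      v ((G *ᵥ u a) (σ 1)) = v.supNorm (u a) := fun a ha => Finset.mem_filter.mp ha
    have hmv : ∀ a, G.submatrix σ σ *ᵥ (u a ∘ σ) = (G *ᵥ u a) ∘ σ := fun a => by
      rw [submatrix_mulVec_equiv, Function.comp_assoc, Equiv.self_comp_symm, Function.comp_id]
    refine card_chart_le hv (G := G.submatrix σ σ) (hG.submatrix σ) (fun i j => hG1 _ _) (T σ)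
      (fun a => u a ∘ σ) (fun a ha h => ?_) (fun a ha i => ?_) (fun a ha => ?_)
      (fun a ha => ?_) (fun a ha b hb c hc hab hac hbc => ?_)
    · have h1 := (hmem a ha).2.1
      simp only [Function.comp_apply] at h
      rw [h, v.map_zero] at h1
      exact (supNorm_pos (h0 a (hmem a ha).1)).ne h1
    · exact (v.le_supNorm (u a) (σ i)).trans (hmem a ha).2.1.ge
    · rw [hmv, comp_equiv_dotProduct_comp_equiv]
      exact hQ a (hmem a ha).1
    · rw [hmv]
      exact (hmem a ha).2.2.trans (hmem a ha).2.1.symm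
    · have h1 := hdet a (hmem a ha).1 b (hmem b hb).1 c (hmem c hc).1 hab hac hbc
      have h2 : (of ![u a ∘ σ, u b ∘ σ, u c ∘ σ]) =
          (of ![u a, u b, u c]).submatrix id σ := by
        ext i j
        fin_cases i <;> rfl
      have h3 : v (of ![u a ∘ σ, u b ∘ σ, u c ∘ σ]).det = v (of ![u a, u b, u c]).det := by
        rw [h2, det_permute', v.map_mul]
        rcases Int.units_eq_one_or (Equiv.Perm.sign σ) with h | h <;> simp [h]
      rw [h3]
      simpa only [Function.comp_apply, (hmem a ha).2.1, (hmem b hb).2.1, (hmem c hc).2.1] using h1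
  refine (Finset.card_le_card hsub).trans ((Finset.card_biUnion_le_card_mul _ _ _ hT).trans_eq ?_)
  simp [Fintype.card_perm, Nat.factorial]

/-- The bound for the number of points on a conic without triangles of area at most `q⁻ⁿ`. -/
def conicBound (q : ℕ) : ℕ → ℕ
  | 0 => 2
  | n + 1 => conicBound q n + 6 * (2 * (q * q ^ (n / 3 + 1)))

/-- Three consecutive steps share the same exponent, so the sum grows geometrically with ratio q and
is dominated by its last terms. -/
theorem conicBound_three_mul_le (hq : 2 ≤ q) (m : ℕ) :
    conicBound q (3 * m) ≤ 74 * q ^ (m + 1) := by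
  induction m with
  | zero => simp [conicBound]; omega
  | succ m ih =>
    have h : conicBound q (3 * (m + 1)) = conicBound q (3 * m) + 36 * (q * q ^ (m + 1)) := by
      rw [show 3 * (m + 1) = 3 * m + 2 + 1 by ring, conicBound, conicBound, conicBound,
        show (3 * m + 2) / 3 = m by omega, show (3 * m + 1) / 3 = m by omega,
        show (3 * m) / 3 = m by omega]
      ring
    have h2 : 2 * q ^ (m + 1) ≤ q * q ^ (m + 1) := Nat.mul_le_mul_right _ hq
    rw [h, pow_succ q (m + 1), mul_comm (q ^ (m + 1)) q]
    omega

theorem det_le (hv : IsNonarchimedean v) (x y z : Fin 3 → K) :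
    v (of ![x, y, z]).det ≤ v.supNorm x * v.supNorm y * v.supNorm z := by
  have h : ∀ i j k, v (x i * y j * z k) ≤ v.supNorm x * v.supNorm y * v.supNorm z :=
    fun i j k => by
      rw [v.map_mul, v.map_mul]
      exact mul_le_mul (mul_le_mul (v.le_supNorm _ _) (v.le_supNorm _ _) (v.nonneg _)
        (v.supNorm_nonneg _)) (v.le_supNorm _ _) (v.nonneg _)
        (mul_nonneg (v.supNorm_nonneg _) (v.supNorm_nonneg _))
  have hd : (of ![x, y, z]).det = x 0 * y 1 * z 2 - x 0 * y 2 * z 1 - x 1 * y 0 * z 2 +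
      x 1 * y 2 * z 0 + x 2 * y 0 * z 1 - x 2 * y 1 * z 0 := by
    rw [det_fin_three]
    simp
  rw [hd]
  exact sub_le_of_nonarch hv (add_le_of_nonarch hv (add_le_of_nonarch hv (sub_le_of_nonarch hv
    (sub_le_of_nonarch hv (h _ _ _) (h _ _ _)) (h _ _ _)) (h _ _ _)) (h _ _ _)) (h _ _ _)

/-- Rescaling of the points at which the reduction of the conic is singular: they lie in a proper
subspace of the reduction, so a linear map of determinant `q` does not increase their norms. -/
theorem exists_matrix_of_singular (hv : v.IsOddLocal q) {G : Matrix (Fin 3) (Fin 3) K}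
    {i j : Fin 3} (hij : v (G i j) = 1) :
    ∃ A : Matrix (Fin 3) (Fin 3) K, v A.det = q ∧
      ∀ x, v ((G *ᵥ x) i) < v.supNorm x → v.supNorm (A *ᵥ x) ≤ v.supNorm x := by
  obtain ⟨p, hp⟩ := hv.exists_uniformizer
  have hq0 : (0 : ℝ) < q := by exact_mod_cast (zero_lt_one.trans hv.one_lt)
  -- Only coordinate `j` changes, to p⁻¹(Gx)ᵢ. This is no larger than the norm of x, because a value
  -- below 1 is at most q⁻¹.
  refine ⟨(1 : Matrix (Fin 3) (Fin 3) K).updateRow j (p⁻¹ • G i), ?_, fun x hx => ?_⟩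
  · have h : ((1 : Matrix (Fin 3) (Fin 3) K).updateRow j (p⁻¹ • G i)).det = p⁻¹ * G i j := by
      rw [det_updateRow_smul, ← cramer_transpose_apply, transpose_one, cramer_one]
      rfl
    rw [h, v.map_mul, hij, mul_one, map_inv₀, hp, inv_inv]
  · refine supNorm_le fun k => ?_
    rw [mulVec]
    by_cases hk : k = j
    · subst hk
      rw [updateRow_self, smul_dotProduct, smul_eq_mul, v.map_mul, map_inv₀, hp, inv_inv]
      obtain ⟨l, hl⟩ := v.exists_eq_supNorm x
      have hpos : 0 < v (x l) := hl ▸ (v.nonneg _).trans_lt hx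
      have h1 : v ((G *ᵥ x) i / x l) < 1 := by
        rw [map_div₀, div_lt_one hpos, hl]
        exact hx
      have h2 := hv.le_inv_of_lt_one _ h1
      rw [map_div₀, div_le_iff₀ hpos, inv_mul_eq_div, le_div_iff₀ hq0, mul_comm, hl] at h2
      exact h2
    · rw [updateRow_ne hk, ← mulVec, one_mulVec]
      exact v.le_supNorm x k

/-- A conic over a field with a discrete absolute value contains few points such that no three of
them span a triangle of small area. -/
theorem card_le_conicBound (hv : v.IsOddLocal q) (n : ℕ) {ι : Type*} (S : Finset ι) :
    ∀ (G : Matrix (Fin 3) (Fin 3) K) (u : ι → Fin 3 → K), G.IsSymm → G ≠ 0 →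
    (∀ a ∈ S, u a ≠ 0) → (∀ a ∈ S, u a ⬝ᵥ G *ᵥ u a = 0) →
    (∀ a ∈ S, ∀ b ∈ S, ∀ c ∈ S, a ≠ b → a ≠ c → b ≠ c →
      (q : ℝ)⁻¹ ^ n * (v.supNorm (u a) * v.supNorm (u b) * v.supNorm (u c)) <
        v (of ![u a, u b, u c]).det) →
    S.card ≤ conicBound q n := by
  have hq0 : (0 : ℝ) < q := by exact_mod_cast (zero_lt_one.trans hv.one_lt)
  induction n generalizing S with
  | zero =>
    intro G u _ _ _ _ hdet
    by_contra! hlt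
    obtain ⟨a, b, c, ha, hb, hc, hab, hac, hbc⟩ := Finset.two_lt_card_iff.mp hlt
    have := hdet a ha b hb c hc hab hac hbc
    rw [pow_zero, one_mul] at this
    exact absurd this (not_lt.mpr (det_le hv.nonarch _ _ _))
  | succ n ih =>
    classical
    -- Dividing `G` by its largest entry leaves the conic unchanged, so `G` may be assumed integral
    -- with a unit entry.
    suffices H : ∀ (G : Matrix (Fin 3) (Fin 3) K) (u : ι → Fin 3 → K), G.IsSymm →
        (∀ i j, v (G i j) ≤ 1) → (∃ i j, v (G i j) = 1) →
        (∀ a ∈ S, u a ≠ 0) → (∀ a ∈ S, u a ⬝ᵥ G *ᵥ u a = 0) →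
        (∀ a ∈ S, ∀ b ∈ S, ∀ c ∈ S, a ≠ b → a ≠ c → b ≠ c →
          (q : ℝ)⁻¹ ^ (n + 1) * (v.supNorm (u a) * v.supNorm (u b) * v.supNorm (u c)) <
            v (of ![u a, u b, u c]).det) → S.card ≤ conicBound q (n + 1) by
      intro G u hG hG0 hu hQ hdet
      obtain ⟨⟨i, j⟩, hij⟩ := Finite.exists_max fun e : Fin 3 × Fin 3 => v (G e.1 e.2)
      have hne : G i j ≠ 0 := fun h => hG0 <| by
        ext k l
        have := hij (k, l)
        simp only [h, v.map_zero] at this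
        exact (v.nonpos_iff).mp this
      refine H ((G i j)⁻¹ • G) u (hG.smul _) (fun k l => ?_) ⟨i, j, ?_⟩ hu (fun a ha => ?_) hdet
      · rw [Matrix.smul_apply, smul_eq_mul, v.map_mul, map_inv₀, inv_mul_eq_div]
        exact div_le_one_of_le₀ (hij (k, l)) (v.nonneg _)
      · rw [Matrix.smul_apply, smul_eq_mul, inv_mul_cancel₀ hne, v.map_one]
      · rw [smul_mulVec, dotProduct_smul, hQ a ha, smul_zero]
    intro G u hG hG1 ⟨i, j, hij⟩ hu hQ hdet
    let smooth : ι → Prop := fun a => ∃ i, v ((G *ᵥ u a) i) = v.supNorm (u a)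
    rw [← Finset.card_filter_add_card_filter_not smooth, conicBound, add_comm]
    refine add_le_add ?_ ?_
    · obtain ⟨A, hA, hAle⟩ := exists_matrix_of_singular hv hij
      have hAdet : IsUnit A.det := isUnit_iff_ne_zero.mpr fun h => by
        rw [h, v.map_zero] at hA
        exact hq0.ne hA
      have hAA : A⁻¹ * A = 1 := nonsing_inv_mul A hAdet
      have hlt : ∀ a ∈ S.filter fun a => ¬ smooth a, v ((G *ᵥ u a) i) < v.supNorm (u a) :=
        fun a ha => lt_of_le_of_ne (mulVec_le hv.nonarch hG1 _ _)
          fun h => (Finset.mem_filter.mp ha).2 ⟨i, h⟩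
      -- The images under `A` lie on the transported conic, and their relative areas have grown by a
      -- factor of at least q. Its Gram matrix need not be integral, which is why the induction
      -- assumes only `G ≠ 0`.
      refine ih _ (A⁻¹ᵀ * G * A⁻¹) (fun a => A *ᵥ u a) ?_ ?_ ?_ ?_ ?_
      · rw [IsSymm, transpose_mul, transpose_mul, transpose_transpose, hG.eq, Matrix.mul_assoc]
      · intro h
        have h1 : Aᵀ * (A⁻¹ᵀ * G * A⁻¹) * A = G := by
          rw [Matrix.mul_assoc, Matrix.mul_assoc, Matrix.mul_assoc, hAA, Matrix.mul_one,
            ← Matrix.mul_assoc, ← transpose_mul, hAA, transpose_one, Matrix.one_mul]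
        rw [h, Matrix.mul_zero, Matrix.zero_mul] at h1
        rw [← h1] at hij
        simp at hij
      · intro a ha h
        refine hu a (Finset.mem_filter.mp ha).1 ?_
        have := congrArg (A⁻¹ *ᵥ ·) h
        simpa [mulVec_mulVec, hAA] using this
      · intro a ha
        rw [mulVec_mulVec, Matrix.mul_assoc, Matrix.mul_assoc, hAA, Matrix.mul_one,
          ← mulVec_mulVec, dotProduct_mulVec, vecMul_transpose, mulVec_mulVec, hAA, one_mulVec]
        exact hQ a (Finset.mem_filter.mp ha).1
      · intro a ha b hb c hc hab hac hbc
        have h1 := hdet a (Finset.mem_filter.mp ha).1 b (Finset.mem_filter.mp hb).1 c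
          (Finset.mem_filter.mp hc).1 hab hac hbc
        have h2 : of ![A *ᵥ u a, A *ᵥ u b, A *ᵥ u c] = of ![u a, u b, u c] * Aᵀ := by
          ext k l
          rw [mul_apply_eq_vecMul, vecMul_transpose]
          fin_cases k <;> rfl
        rw [h2, det_mul, det_transpose, v.map_mul, hA]
        have ha' := hAle _ (hlt a ha)
        have hb' := hAle _ (hlt b hb)
        have hc' := hAle _ (hlt c hc)
        have h3 : v.supNorm (A *ᵥ u a) * v.supNorm (A *ᵥ u b) * v.supNorm (A *ᵥ u c) ≤
            v.supNorm (u a) * v.supNorm (u b) * v.supNorm (u c) :=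
          mul_le_mul (mul_le_mul ha' hb' (v.supNorm_nonneg _) (v.supNorm_nonneg _)) hc'
            (v.supNorm_nonneg _) (mul_nonneg (v.supNorm_nonneg _) (v.supNorm_nonneg _))
        calc _ ≤ (q : ℝ)⁻¹ ^ n * (v.supNorm (u a) * v.supNorm (u b) * v.supNorm (u c)) :=
              mul_le_mul_of_nonneg_left h3 (by positivity)
          _ = (q : ℝ)⁻¹ ^ (n + 1) * (v.supNorm (u a) * v.supNorm (u b) * v.supNorm (u c)) * q := by
            rw [pow_succ]
            field_simp
          _ < _ := mul_lt_mul_of_pos_right h1 hq0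
    · refine card_smooth_le hv hG hG1 _ u
        (fun a ha => hu a (Finset.mem_filter.mp ha).1) (fun a ha => hQ a (Finset.mem_filter.mp ha).1)
        (fun a ha => (Finset.mem_filter.mp ha).2) (fun a ha b hb c hc hab hac hbc => ?_)
      refine lt_of_le_of_lt (mul_le_mul_of_nonneg_right ?_ ?_) (hdet a (Finset.mem_filter.mp ha).1 b
        (Finset.mem_filter.mp hb).1 c (Finset.mem_filter.mp hc).1 hab hac hbc)
      -- The exponent m = n/3 + 1 satisfies 3m ≥ n + 1, despite the floor.
      · exact pow_le_pow_of_le_one (by positivity)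
          (inv_le_one_of_one_le₀ (by exact_mod_cast hv.one_lt.le)) (by omega)
      · exact mul_nonneg (mul_nonneg (v.supNorm_nonneg _) (v.supNorm_nonneg _))
          (v.supNorm_nonneg _)

end AbsoluteValue

/-! ### Places of a number field above `3` -/

section NumberField

open IsDedekindDomain NumberField WithZeroMulInt

variable (k : Type*) [Field k] [NumberField k]

theorem exists_heightOneSpectrum_three_mem :
    ∃ w : HeightOneSpectrum (𝓞 k), (3 : 𝓞 k) ∈ w.asIdeal := by
  have hmax : (Ideal.span {(3 : ℤ)}).IsMaximal :=
    PrincipalIdealRing.isMaximal_of_irreducible Int.prime_three.irreducible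
  obtain ⟨P, hP, hover⟩ :=
    Ideal.exists_maximal_ideal_liesOver_of_isIntegral (S := 𝓞 k) (Ideal.span {(3 : ℤ)})
  have h3 : (3 : 𝓞 k) ∈ P := by
    have := (Ideal.mem_of_liesOver P (Ideal.span {(3 : ℤ)}) 3).mp (Ideal.mem_span_singleton_self 3)
    simpa using this
  exact ⟨⟨P, hP.isPrime, fun h => by rw [h] at h3; simp at h3⟩, h3⟩

theorem adicAbv_isOddLocal (w : HeightOneSpectrum (𝓞 k)) (hw : (3 : 𝓞 k) ∈ w.asIdeal) :
    (HeightOneSpectrum.adicAbv k w).IsOddLocal (Ideal.absNorm w.asIdeal) := by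
  have hq := HeightOneSpectrum.one_lt_absNorm w
  have hq' := HeightOneSpectrum.one_lt_absNorm_nnreal w
  have hmono := toNNReal_strictMono hq'
  have hexp : ∀ m : ℕ, ((toNNReal (HeightOneSpectrum.absNorm_ne_zero w)
      (WithZero.exp (-(m : ℤ))) : NNReal) : ℝ) = ((Ideal.absNorm w.asIdeal : ℕ) : ℝ)⁻¹ ^ m := by
    intro m
    have h : (WithZero.unzero (WithZero.exp_ne_zero (a := -(m : ℤ)))).toAdd = -(m : ℤ) := rfl
    rw [toNNReal_neg_apply _ WithZero.exp_ne_zero, h]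
    simp
  have hle : ∀ (m : ℕ) (x : k), HeightOneSpectrum.adicAbv k w x ≤
      ((Ideal.absNorm w.asIdeal : ℕ) : ℝ)⁻¹ ^ m ↔
        w.valuation k x ≤ WithZero.exp (-(m : ℤ)) := by
    intro m x
    rw [← hexp, HeightOneSpectrum.adicAbv_def, NNReal.coe_le_coe, hmono.le_iff_le]
  have hle1 : ∀ x : k, HeightOneSpectrum.adicAbv k w x ≤ 1 ↔ w.valuation k x ≤ 1 := fun x => by
    simpa using hle 0 x
  refine ⟨HeightOneSpectrum.isNonarchimedean_adicAbv k w, hq, ?_, fun x hx => ?_, ?_, fun m => ?_⟩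
  · have h2 : (2 : 𝓞 k) ∉ w.asIdeal := fun h => w.isPrime.ne_top <|
      (Ideal.eq_top_iff_one _).mpr <| by
        have := w.asIdeal.sub_mem hw h
        rwa [show (3 : 𝓞 k) - 2 = 1 by norm_num] at this
    have := (w.adicAbv_coe_eq_one_iff (K := k) hq' (r := 2)).mpr h2
    rw [map_ofNat] at this
    exact this
  · have h1 : w.valuation k x < 1 := by
      rw [HeightOneSpectrum.adicAbv_def, ← NNReal.coe_one, NNReal.coe_lt_coe,
        ← map_one (toNNReal (HeightOneSpectrum.absNorm_ne_zero w)), hmono.lt_iff_lt] at hx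
      exact hx
    have := (hle 1 x).mpr ?_
    · rwa [pow_one] at this
    · by_cases hx0 : w.valuation k x = 0
      · simp [hx0]
      · rw [← WithZero.exp_log hx0, ← WithZero.exp_zero, WithZero.exp_lt_exp] at h1
        rw [← WithZero.exp_log hx0, WithZero.exp_le_exp]
        push_cast
        omega
  · obtain ⟨p, hp⟩ := w.valuation_exists_uniformizer k
    refine ⟨p, ?_⟩
    rw [HeightOneSpectrum.adicAbv_def, hp]
    simpa using hexp 1
  · classical
    have happrox : ∀ x : k, ∃ a : 𝓞 k, HeightOneSpectrum.adicAbv k w x ≤ 1 →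
        w.valuation k (algebraMap (𝓞 k) k a - x) ≤ WithZero.exp (-(m : ℤ)) := by
      intro x
      by_cases hx : HeightOneSpectrum.adicAbv k w x ≤ 1
      · obtain ⟨a, ha⟩ := w.exists_valuation_sub_lt_of_integer ((hle1 x).mp hx)
          (Units.mk0 (WithZero.exp (-(m : ℤ))) WithZero.exp_ne_zero)
        exact ⟨a, fun _ => ha.le⟩
      · exact ⟨0, fun h => absurd h hx⟩
    choose a ha using happrox
    have hcard : Nat.card (𝓞 k ⧸ w.asIdeal ^ m) = Ideal.absNorm w.asIdeal ^ m := by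
      rw [← map_pow]
      rfl
    have hfin : Finite (𝓞 k ⧸ w.asIdeal ^ m) :=
      Nat.finite_of_card_ne_zero (hcard ▸ pow_ne_zero _ (zero_lt_one.trans hq).ne')
    let e := (Finite.equivFin (𝓞 k ⧸ w.asIdeal ^ m)).trans (finCongr hcard)
    refine ⟨fun x => e (Ideal.Quotient.mk _ (a x)), fun x y hx hy hxy => ?_⟩
    have h1 := Ideal.Quotient.eq.mp (e.injective hxy)
    rw [← w.intValuation_le_pow_iff_mem, ← w.valuation_of_algebraMap (K := k)] at h1
    replace h1 : w.valuation k (algebraMap (𝓞 k) k (a x) - algebraMap (𝓞 k) k (a y)) ≤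
        WithZero.exp (-(m : ℤ)) := by
      rw [← map_sub]
      exact h1
    rw [hle]
    have h2 : x - y = (algebraMap (𝓞 k) k (a x) - algebraMap (𝓞 k) k (a y)) -
      (algebraMap (𝓞 k) k (a x) - x) + (algebraMap (𝓞 k) k (a y) - y) := by ring
    rw [h2]
    exact Valuation.map_add_le _ (Valuation.map_sub_le _ h1 (ha x hx)) (ha y hy)

end NumberField

/-! ### The product formula for determinants -/

section Height

open Height AdmissibleAbsValues Function AbsoluteValue Matrix

variable {K : Type*} [Field K]

theorem AbsoluteValue.det_le_six_mul (v : AbsoluteValue K ℝ) (x y z : Fin 3 → K) :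
    v (of ![x, y, z]).det ≤ 6 * (v.supNorm x * v.supNorm y * v.supNorm z) := by
  have h : ∀ i j k, v (x i * y j * z k) ≤ v.supNorm x * v.supNorm y * v.supNorm z :=
    fun i j k => by
      rw [v.map_mul, v.map_mul]
      exact mul_le_mul (mul_le_mul (v.le_supNorm _ _) (v.le_supNorm _ _) (v.nonneg _)
        (v.supNorm_nonneg _)) (v.le_supNorm _ _) (v.nonneg _)
        (mul_nonneg (v.supNorm_nonneg _) (v.supNorm_nonneg _))
  have hd : (of ![x, y, z]).det = x 0 * y 1 * z 2 + -(x 0 * y 2 * z 1) + -(x 1 * y 0 * z 2) +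
      x 1 * y 2 * z 0 + x 2 * y 0 * z 1 + -(x 2 * y 1 * z 0) := by
    rw [det_fin_three]
    simp only [of_apply, cons_val_zero, cons_val_one, cons_val]
    ring
  rw [hd]
  refine (v.add_le _ _).trans ?_
  grw [v.add_le, v.add_le, v.add_le, v.add_le]
  simp only [v.map_neg]
  linarith [h 0 1 2, h 0 2 1, h 1 0 2, h 1 2 0, h 2 0 1, h 2 1 0]

variable [AdmissibleAbsValues K]

/-- Dropping the zero coordinates leaves the supremum unchanged, and each nonzero coordinate has
absolute value 1 at almost all places. -/
theorem hasFiniteMulSupport_supNorm {x : Fin 3 → K} (hx : x ≠ 0) :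
    (fun v : nonarchAbsVal (K := K) ↦ v.val.supNorm x).HasFiniteMulSupport := by
  have : Nonempty {j // x j ≠ 0} := nonempty_subtype.mpr <| ne_iff.mp hx
  suffices (fun v : nonarchAbsVal (K := K) ↦
      ⨆ i : {j // x j ≠ 0}, v.val (x i)).HasFiniteMulSupport by
    convert! this with v
    refine le_antisymm (supNorm_le fun j ↦ ?_) (ciSup_le fun ⟨j, hj⟩ ↦ v.val.le_supNorm x j)
    rcases eq_or_ne (x j) 0 with h | h
    · rw [h, v.val.map_zero]
      exact Real.iSup_nonneg fun i => v.val.nonneg _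
    · exact Finite.le_ciSup_of_le ⟨j, h⟩ le_rfl
  fun_prop (disch := grind)

theorem mulHeight_eq_supNorm {x : Fin 3 → K} (hx : x ≠ 0) :
    mulHeight x = (archAbsVal.map fun v ↦ v.supNorm x).prod *
      ∏ᶠ v : nonarchAbsVal (K := K), v.val.supNorm x :=
  mulHeight_eq hx

/-- A nonzero determinant is not small at a single place, by the product formula. -/
theorem supNorm_le_det_mul_mulHeight {w : AbsoluteValue K ℝ} (hw : w ∈ nonarchAbsVal (K := K))
    {x y z : Fin 3 → K} (hx : x ≠ 0) (hy : y ≠ 0) (hz : z ≠ 0) (hd : (of ![x, y, z]).det ≠ 0) :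
    w.supNorm x * w.supNorm y * w.supNorm z ≤ w (of ![x, y, z]).det *
      (6 ^ totalWeight K * (mulHeight x * mulHeight y * mulHeight z)) := by
  classical
  set d := (of ![x, y, z]).det with hddef
  set c := (w.supNorm x * w.supNorm y * w.supNorm z) / w d with hc
  have hwd : 0 < w d := w.pos hd
  have hc0 : 0 ≤ c := div_nonneg (mul_nonneg (mul_nonneg (w.supNorm_nonneg _) (w.supNorm_nonneg _))
    (w.supNorm_nonneg _)) hwd.le
  -- The factor `c`, placed at `w` alone, turns the determinant bound there into an equality, so one
  -- comparison of products over all finite places suffices.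
  let g : nonarchAbsVal (K := K) → ℝ := fun v => if v.val = w then c else 1
  have hg0 : ∀ v, 0 ≤ g v := fun v => by
    simp only [g]
    split_ifs
    exacts [hc0, zero_le_one]
  have hgfin : g.HasFiniteMulSupport := by
    refine (Set.finite_singleton (⟨w, hw⟩ : nonarchAbsVal (K := K))).subset fun v hv => ?_
    by_contra h
    refine hv (if_neg fun h' => h (Subtype.ext h'))
  have hgprod : ∏ᶠ v, g v = c := by
    rw [finprod_eq_single g ⟨w, hw⟩ fun v hv => if_neg fun h' => hv (Subtype.ext h')]
    exact if_pos rfl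
  have hdfin := hasFiniteMulSupport hd
  have hxf := hasFiniteMulSupport_supNorm hx
  have hyf := hasFiniteMulSupport_supNorm hy
  have hzf := hasFiniteMulSupport_supNorm hz
  have hxyf : (fun v : nonarchAbsVal (K := K) ↦
      v.val.supNorm x * v.val.supNorm y).HasFiniteMulSupport := hxf.mul hyf
  have hfin : (∏ᶠ v : nonarchAbsVal (K := K), v.val d) * c ≤
      (∏ᶠ v : nonarchAbsVal (K := K), v.val.supNorm x) *
      (∏ᶠ v : nonarchAbsVal (K := K), v.val.supNorm y) *
      (∏ᶠ v : nonarchAbsVal (K := K), v.val.supNorm z) := by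
    rw [← hgprod, ← finprod_mul_distrib hdfin hgfin, ← finprod_mul_distrib hxf hyf,
      ← finprod_mul_distrib hxyf hzf]
    refine finprod_le_finprod (hdfin.mul hgfin) (fun v => mul_nonneg (v.val.nonneg _) (hg0 v))
      (hxyf.mul hzf) fun v => ?_
    simp only [g]
    split_ifs with h
    · rw [h, hc, mul_div_cancel₀ _ hwd.ne']
    · rw [mul_one]
      exact det_le (isNonarchimedean _ v.2) x y z
  have harch : (archAbsVal.map fun v : AbsoluteValue K ℝ ↦ v d).prod ≤ 6 ^ totalWeight K *
      ((archAbsVal.map fun v : AbsoluteValue K ℝ ↦ v.supNorm x).prod *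
      (archAbsVal.map fun v : AbsoluteValue K ℝ ↦ v.supNorm y).prod *
      (archAbsVal.map fun v : AbsoluteValue K ℝ ↦ v.supNorm z).prod) := by
    have h := Multiset.prod_map_le_prod_map₀ (s := archAbsVal (K := K)) (fun v => v d)
      (fun v => 6 * (v.supNorm x * v.supNorm y * v.supNorm z)) (fun v _ => v.nonneg _)
      (fun v _ => v.det_le_six_mul x y z)
    simpa only [Multiset.prod_map_mul, Multiset.map_const', Multiset.prod_replicate,
      totalWeight] using h
  have harch0 : 0 ≤ (archAbsVal.map fun v : AbsoluteValue K ℝ ↦ v d).prod :=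
    Multiset.prod_nonneg fun r hr => by
      obtain ⟨v, -, rfl⟩ := Multiset.mem_map.mp hr
      exact v.nonneg _
  have hfin0 : 0 ≤ ∏ᶠ v : nonarchAbsVal (K := K), v.val d := finprod_nonneg fun v => v.val.nonneg _
  have hpf := product_formula hd
  rw [← div_le_iff₀' hwd, ← hc, mulHeight_eq_supNorm hx, mulHeight_eq_supNorm hy,
    mulHeight_eq_supNorm hz]
  calc c = ((archAbsVal.map fun v : AbsoluteValue K ℝ ↦ v d).prod) *
        ((∏ᶠ v : nonarchAbsVal (K := K), v.val d) * c) := by rw [← mul_assoc, hpf, one_mul]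
    _ ≤ _ := mul_le_mul harch hfin (mul_nonneg hfin0 hc0) (harch0.trans harch)
    _ = _ := by ring

end Height

/-! ### Points on irreducible conics -/

section Conic

open MvPolynomial Matrix

variable {K : Type*} [Field K]

theorem exists_eval_eq_dotProduct {n : Type*} [Fintype n] {p : MvPolynomial n K}
    (hp : p ∈ homogeneousSubmodule n K 1) : ∃ a : n → K, ∀ x, eval x p = a ⬝ᵥ x := by
  classical
  rw [homogeneousSubmodule_one_eq_span_X] at hp
  induction hp using Submodule.span_induction with
  | mem p hp =>
    obtain ⟨i, rfl⟩ := hp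
    exact ⟨Pi.single i 1, fun x => by simp⟩
  | zero => exact ⟨0, fun x => by simp⟩
  | add p r _ _ hp hr =>
    obtain ⟨a, ha⟩ := hp
    obtain ⟨b, hb⟩ := hr
    exact ⟨a + b, fun x => by rw [map_add, ha, hb, add_dotProduct]⟩
  | smul c p _ hp =>
    obtain ⟨a, ha⟩ := hp
    exact ⟨c • a, fun x => by rw [smul_eval, ha, smul_dotProduct, smul_eq_mul]⟩

/-- The Gram matrix of a quadratic form. -/
theorem MvPolynomial.IsHomogeneous.exists_gram {n : Type*} [Fintype n] {Q : MvPolynomial n K}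
    (hQ : Q.IsHomogeneous 2) :
    ∃ G : Matrix n n K, G.IsSymm ∧ ∀ x, x ⬝ᵥ G *ᵥ x = 2 * eval x Q := by
  have hmem : Q ∈ homogeneousSubmodule n K 1 * homogeneousSubmodule n K 1 := by
    rw [← pow_two, homogeneousSubmodule_one_pow]
    exact hQ
  clear hQ
  induction hmem using Submodule.mul_induction_on' with
  | mem_mul_mem p hp r hr =>
    obtain ⟨a, ha⟩ := exists_eval_eq_dotProduct hp
    obtain ⟨b, hb⟩ := exists_eval_eq_dotProduct hr
    refine ⟨vecMulVec a b + vecMulVec b a, ?_, fun x => ?_⟩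
    · rw [IsSymm, transpose_add, transpose_vecMulVec, transpose_vecMulVec, add_comm]
    · rw [add_mulVec, vecMulVec_mulVec, vecMulVec_mulVec, map_mul, ha, hb]
      simp only [op_smul_eq_smul, dotProduct_comm x, add_dotProduct, smul_dotProduct, smul_eq_mul]
      ring
  | add p _ r _ hp hr =>
    obtain ⟨G, hG, hGe⟩ := hp
    obtain ⟨H, hH, hHe⟩ := hr
    refine ⟨G + H, hG.add hH, fun x => ?_⟩
    rw [add_mulVec, dotProduct_add, hGe, hHe, map_add]
    ring

/-- A polynomial vanishing on a hyperplane is divisible by its equation. -/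
theorem MvPolynomial.dvd_of_eval_eq_zero {n : Type*} [Fintype n] [Infinite K] {w : n → K}
    (hw : w ≠ 0) {Q : MvPolynomial n K} (hQ : ∀ x, w ⬝ᵥ x = 0 → eval x Q = 0) :
    (∑ i, C (w i) * X i) ∣ Q := by
  classical
  obtain ⟨j, hj⟩ := Function.ne_iff.mp hw
  replace hj : w j ≠ 0 := hj
  set l : MvPolynomial n K := ∑ i, C (w i) * X i with hl
  -- This substitution is the projection onto the hyperplane along the `j`-th axis. It kills `Q`, as
  -- the field is infinite, and is the identity modulo `l`.
  let φ : MvPolynomial n K →ₐ[K] MvPolynomial n K :=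
    aeval fun i => X i - if i = j then C (w j)⁻¹ * l else 0
  have h1 : φ Q = 0 := by
    refine MvPolynomial.funext fun x => ?_
    have h2 : eval x (φ Q) = eval (fun i => x i - if i = j then (w j)⁻¹ * (w ⬝ᵥ x) else 0) Q := by
      rw [← coe_aeval_eq_eval, ← coe_aeval_eq_eval, RingHom.coe_coe, RingHom.coe_coe,
        ← AlgHom.comp_apply]
      congr 1
      refine MvPolynomial.algHom_ext fun i => ?_
      simp only [φ, AlgHom.comp_apply, aeval_X, map_sub]
      split_ifs
      · simp [hl, dotProduct]
      · simp
    rw [h2, hQ, map_zero]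
    have h3 : (fun i => x i - if i = j then (w j)⁻¹ * (w ⬝ᵥ x) else 0) =
        x - Pi.single j ((w j)⁻¹ * (w ⬝ᵥ x)) := by
      ext i
      simp [Pi.single_apply]
    rw [h3, dotProduct_sub, dotProduct_single, mul_inv_cancel_left₀ hj, sub_self]
  have h2 : (Ideal.Quotient.mkₐ K (Ideal.span {l})).comp φ =
      Ideal.Quotient.mkₐ K (Ideal.span {l}) := by
    refine MvPolynomial.algHom_ext fun i => ?_
    simp only [φ, AlgHom.comp_apply, aeval_X, Ideal.Quotient.mkₐ_eq_mk]
    rw [Ideal.Quotient.eq, Ideal.mem_span_singleton]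
    split_ifs
    · exact ⟨-C (w j)⁻¹, by ring⟩
    · exact ⟨0, by ring⟩
  have h3 := DFunLike.congr_fun h2 Q
  rw [AlgHom.comp_apply, h1, map_zero] at h3
  rw [← Ideal.mem_span_singleton, ← Ideal.Quotient.eq_zero_iff_mem]
  exact h3.symm

theorem exists_eq_add_of_det_eq_zero {x y t : Fin 3 → K} (hxy : LinearIndependent K ![x, y])
    (h : (of ![x, y, t]).det = 0) : ∃ a b : K, t = a • x + b • y := by
  obtain ⟨c, hc, hc0⟩ := exists_vecMul_eq_zero_iff.mpr h
  have hsum : c 0 • x + c 1 • y + c 2 • t = 0 := by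
    rw [← hc0, vecMul_eq_sum, Fin.sum_univ_three]
    rfl
  have hc2 : c 2 ≠ 0 := fun h2 => hc <| by
    rw [h2, zero_smul, add_zero] at hsum
    obtain ⟨h0, h1⟩ := LinearIndependent.pair_iff.mp hxy _ _ hsum
    ext i
    fin_cases i
    exacts [h0, h1, h2]
  refine ⟨-(c 2)⁻¹ * c 0, -(c 2)⁻¹ * c 1, ?_⟩
  have h3 : t = (c 2)⁻¹ • (c 2 • t) := by rw [smul_smul, inv_mul_cancel₀ hc2, one_smul]
  rw [h3, show c 2 • t = -(c 0 • x + c 1 • y) from (neg_eq_of_add_eq_zero_right hsum).symm]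
  module

/-- Three distinct rational points of an irreducible conic are not collinear. -/
theorem IsIrreducibleConic.det_ne_zero [CharZero K] {Q : MvPolynomial (Fin 3) K}
    (hQ : IsIrreducibleConic Q) {x y z : Fin 3 → K} (hxy : LinearIndependent K ![x, y])
    (hxz : LinearIndependent K ![x, z]) (hyz : LinearIndependent K ![y, z])
    (hx : eval x Q = 0) (hy : eval y Q = 0) (hz : eval z Q = 0) :
    (of ![x, y, z]).det ≠ 0 := by
  intro hdet
  obtain ⟨w, hw, hw0⟩ := exists_mulVec_eq_zero_iff.mpr hdet
  have hwx : x ⬝ᵥ w = 0 := congrFun hw0 0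
  have hwy : y ⬝ᵥ w = 0 := congrFun hw0 1
  obtain ⟨G, hG, hGe⟩ := hQ.1.exists_gram
  have hsymm : y ⬝ᵥ G *ᵥ x = x ⬝ᵥ G *ᵥ y := by
    rw [dotProduct_mulVec, ← mulVec_transpose, hG.eq, dotProduct_comm]
  have hspan : ∀ a b : K, 2 * eval (a • x + b • y) Q = 2 * (a * b * (x ⬝ᵥ G *ᵥ y)) := fun a b => by
    have h1 := hGe x
    have h2 := hGe y
    rw [hx, mul_zero] at h1
    rw [hy, mul_zero] at h2
    rw [← hGe]
    simp only [mulVec_add, mulVec_smul, add_dotProduct, dotProduct_add, smul_dotProduct,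
      dotProduct_smul, smul_eq_mul, h1, h2, hsymm]
    ring
  -- On the span of x and y the form is a multiple of the product of the two coefficients. Both are
  -- nonzero at z, so the form vanishes on the whole line.
  have hB : x ⬝ᵥ G *ᵥ y = 0 := by
    obtain ⟨a, b, rfl⟩ := exists_eq_add_of_det_eq_zero hxy hdet
    have h := hspan a b
    rw [hz, mul_zero] at h
    have ha : a ≠ 0 := fun h0 => by
      have := (LinearIndependent.pair_iff.mp hyz b (-1) (by rw [h0]; module)).2
      simp at this
    have hb : b ≠ 0 := fun h0 => by
      have := (LinearIndependent.pair_iff.mp hxz a (-1) (by rw [h0]; module)).2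
      simp at this
    simpa [ha, hb] using h.symm
  have hdvd := MvPolynomial.dvd_of_eval_eq_zero hw (Q := Q) fun t ht => by
    have h0 : (of ![x, y, t]).det = 0 := by
      refine exists_mulVec_eq_zero_iff.mp ⟨w, hw, ?_⟩
      ext i
      fin_cases i
      exacts [hwx, hwy, (dotProduct_comm t w).trans ht]
    obtain ⟨a, b, rfl⟩ := exists_eq_add_of_det_eq_zero hxy h0
    simpa [hB] using hspan a b
  obtain ⟨R, hR⟩ := hdvd
  have hl : (∑ i, C (w i) * X i : MvPolynomial (Fin 3) K).IsHomogeneous 1 :=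
    IsHomogeneous.sum _ _ _ fun i _ => isHomogeneous_C_mul_X _ _
  rcases hQ.2.isUnit_or_isUnit hR with h | h
  · obtain ⟨c, hc, hc'⟩ := MvPolynomial.isUnit_iff_eq_C_of_isReduced.mp h
    have := congrArg (eval 0) hc'
    simp at this
    exact hc.ne_zero this.symm
  -- A constant cofactor would make `Q` homogeneous of degree 1 as well as 2.
  · obtain ⟨c, -, hc'⟩ := MvPolynomial.isUnit_iff_eq_C_of_isReduced.mp h
    have h1 : Q.IsHomogeneous 1 := by
      rw [hR, hc']
      simpa using hl.mul (isHomogeneous_C (Fin 3) c)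
    exact absurd (h1.inj_right hQ.1 hQ.2.ne_zero) (by norm_num)

end Conic

/-! ### The uniform bound for points of bounded height -/

section Count

open NumberField Height Height.AdmissibleAbsValues Matrix AbsoluteValue

theorem Projectivization.linearIndependent_rep {K V : Type*} [Field K] [AddCommGroup V]
    [Module K V] {x y : ℙ K V} (h : x ≠ y) : LinearIndependent K ![x.rep, y.rep] := by
  have := Projectivization.independent_iff.mp ((Projectivization.independent_pair_iff_ne x y).mpr h)
  convert this using 1
  ext i
  fin_cases i <;> rfl

theorem card_rationalPointsOfHeightLE_le {k : Type*} [Field k] [NumberField k]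
    {w : AbsoluteValue k ℝ} (hw : w ∈ nonarchAbsVal (K := k)) {q : ℕ} (hv : w.IsOddLocal q)
    {Q : MvPolynomial (Fin 3) k} (hQ : IsIrreducibleConic Q) {B : ℝ} (hB : 1 ≤ B)
    (S : Finset (ℙ k (Fin 3 → k))) (hS : ∀ x ∈ S, x ∈ rationalPointsOfHeightLE Q B) :
    (S.card : ℝ) ≤ 74 * q ^ 2 * 6 ^ totalWeight k * B := by
  have hq0 : (0 : ℝ) < q := by exact_mod_cast (zero_lt_one.trans hv.one_lt)
  have h6 : (1 : ℝ) ≤ 6 ^ totalWeight k := one_le_pow₀ (by norm_num)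
  have h6B : 1 ≤ 6 ^ totalWeight k * B := one_le_mul_of_one_le_of_one_le h6 hB
  -- With t the total weight, q^m ≤ 6^t B < q^(m+1). The upper inequality excludes triangles of area
  -- at most q^(-3(m+1)); the lower one makes the count linear in B.
  obtain ⟨m, hm1, hm2⟩ := exists_nat_pow_near h6B (y := (q : ℝ)) (by exact_mod_cast hv.one_lt)
  obtain ⟨G, hG, hGe⟩ := hQ.1.exists_gram
  have hG0 : G ≠ 0 := fun h => hQ.2.ne_zero <| MvPolynomial.funext fun x => by
    have := hGe x
    rw [h, zero_mulVec, dotProduct_zero] at this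
    simpa using this.symm
  have hmem : ∀ x ∈ S, MvPolynomial.eval x.rep Q = 0 ∧ mulHeight x.rep ≤ B := fun x hx => by
    refine ⟨(hS x hx).1, ?_⟩
    rw [← Projectivization.mulHeight_mk x.rep_nonzero, x.mk_rep]
    exact (hS x hx).2
  have hcard := card_le_conicBound hv (3 * (m + 1)) S G (fun x => x.rep) hG hG0
    (fun x _ => x.rep_nonzero) (fun x hx => by rw [hGe, (hmem x hx).1, mul_zero])
    fun x hx y hy z hz hxy hxz hyz => by
      have hdet := hQ.det_ne_zero (Projectivization.linearIndependent_rep hxy)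
        (Projectivization.linearIndependent_rep hxz) (Projectivization.linearIndependent_rep hyz)
        (hmem x hx).1 (hmem y hy).1 (hmem z hz).1
      have h := supNorm_le_det_mul_mulHeight hw x.rep_nonzero y.rep_nonzero z.rep_nonzero hdet
      have hwd : 0 < w (of ![x.rep, y.rep, z.rep]).det := w.pos hdet
      have hH : mulHeight x.rep * mulHeight y.rep * mulHeight z.rep ≤ B ^ 3 := by
        rw [pow_succ, pow_two]
        have := (mulHeight_pos y.rep).le
        have := (mulHeight_pos z.rep).le
        have := (hmem x hx).2
        have := (hmem y hy).2
        have := (hmem z hz).2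
        gcongr
      have hlt : 6 ^ totalWeight k * (mulHeight x.rep * mulHeight y.rep * mulHeight z.rep) <
          (q : ℝ) ^ (3 * (m + 1)) := by
        calc _ ≤ (6 : ℝ) ^ totalWeight k * B ^ 3 := by gcongr
          _ ≤ (6 ^ totalWeight k) ^ 3 * B ^ 3 := by
            gcongr
            exact le_self_pow₀ h6 (by norm_num)
          _ = (6 ^ totalWeight k * B) ^ 3 := by rw [mul_pow]
          _ < ((q : ℝ) ^ (m + 1)) ^ 3 := pow_lt_pow_left₀ hm2 (by positivity) (by norm_num)
          _ = _ := by rw [← pow_mul, mul_comm]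
      rw [inv_pow, inv_mul_lt_iff₀ (by positivity), mul_comm (_ ^ _)]
      exact h.trans_lt (mul_lt_mul_of_pos_left hlt hwd)
  calc (S.card : ℝ) ≤ ((74 * q ^ (m + 1 + 1) : ℕ) : ℝ) := by
        exact_mod_cast hcard.trans (conicBound_three_mul_le hv.one_lt (m + 1))
    _ = 74 * q ^ 2 * (q : ℝ) ^ m := by push_cast; ring
    _ ≤ 74 * q ^ 2 * (6 ^ totalWeight k * B) := by gcongr
    _ = _ := by ring

end Count

theorem corollary4p7 (k : Type*) [Field k] [NumberField k] :
    ∃ c : ℝ, ∀ Q : MvPolynomial (Fin 3) k, IsIrreducibleConic Q → ∀ B : ℝ, 1 ≤ B →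
      (rationalPointsOfHeightLE Q B).Finite ∧
        ((rationalPointsOfHeightLE Q B).ncard : ℝ) ≤ c * B := by
  obtain ⟨w, hw3⟩ := exists_heightOneSpectrum_three_mem k
  have hv := adicAbv_isOddLocal k w hw3
  have hw : NumberField.HeightOneSpectrum.adicAbv k w ∈
      Height.AdmissibleAbsValues.nonarchAbsVal (K := k) := by
    refine ⟨w, ?_⟩
    ext x
    exact NumberField.FinitePlace.norm_embedding w x
  refine ⟨74 * (Ideal.absNorm w.asIdeal : ℕ) ^ 2 * 6 ^ Height.totalWeight k, fun Q hQ B hB => ?_⟩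
  have hbound := fun S => card_rationalPointsOfHeightLE_le hw hv hQ hB S
  -- The bound holds for every finite subset, so the set itself cannot be infinite.
  have hfin : (rationalPointsOfHeightLE Q B).Finite := by
    by_contra hinf
    obtain ⟨N, hN⟩ := exists_nat_gt
      (74 * (Ideal.absNorm w.asIdeal : ℕ) ^ 2 * 6 ^ Height.totalWeight k * B)
    obtain ⟨S, hS, hcard⟩ := Set.Infinite.exists_subset_card_eq hinf N
    have := hbound S fun x hx => hS hx
    rw [hcard] at this
    exact absurd hN (not_lt.mpr this)
  refine ⟨hfin, ?_⟩
  rw [Set.ncard_eq_toFinset_card _ hfin]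
  exact hbound _ fun x hx => hfin.mem_toFinset.mp hx
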